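/- Let $S$ be a closed topological surface with a finite cellular decomposition with sets of vertices, edges and faces $V,E,F$ (each face is a polygon with at least one side, glued along the edges; the faces on the two sides of an edge may coincide). Let $\Phi:E\to(0,\frac{\pi}{2})$ be a weight. For $\phi\in(0,\frac{\pi}{2})$ and $k_1,k_2\ge 0$ let $r_1,r_2\in(0,\frac{\pi}{2}]$ be given by $\cot r_i=k_i$, let $D_1,D_2$ be disks of radii $r_1,r_2$ in the unit sphere $\mathbb{S}^2$ whose intersection is a bigon of interior angle $\phi$, and let $\ell_1$ be the length of the side $\partial D_1\cap D_2$ of this bigon; put $L_\phi(k_1,k_2)=\ell_1k_1$, the total geodesic curvature of that side. A vector $k\in\mathbb{R}_{\ge0}^{F}$ stands for the spherical conical metric on $S$ whose circle pattern realizes $\Phi$ and whose circle at the face $f$ has geodesic curvature $k_f$ (this determines the metric with its pattern up to isometry); it is called a degenerated circle pattern metric if $k_f=0$ for some $f$. Its total geodesic curvature at $f$ is $$L_f(k)=\sum_{s}L_{\Phi(e(s))}(k_f,k_{f'(s)}),$$ where $s$ runs over the sides of the polygon $f$, $e(s)$ is the edge of $s$, and $f'(s)$ is the face on the other side of $e(s)$.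 For $\emptyset\ne I\subsetneq F$ (so $I=F_{i_1\cdots i_m}=\{i_1,\dots,i_m\}$ with $1\le m\le|F|-1$) let $\mathbb{R}^{|F|}_{I}$ be the set of $k\in\mathbb{R}^{F}$ with $k_f>0$ for $f\in I$ and $k_f=0$ for $f\notin I$, and let $$\mathcal{L}_{I}=\Big\{L\in\mathbb{R}^{|F|}_{I}\ \Big|\ \sum_{f\in F'}L_f<2\sum_{e\in E_{F'}}\Phi(e)\ \text{ for all } \emptyset\neq F'\subset I\Big\},$$ where $E_{F'}$ is the set of edges lying on the boundary of some face in $F'$. Let $\hat L\in\mathcal{L}_{I}$. Then there is a unique degenerated circle pattern metric $\hat k$ with $L_f(\hat k)=\hat L_f$ for $f\in I$ and $L_f(\hat k)=0$ for $f\in F\setminus I$, and $\hat k\in\mathbb{R}^{|F|}_{I}$. Moreover, for every initial value $\tilde k(0)\in\mathbb{R}_{>0}^{I}$ the reduced prescribed combinatorial Ricci flow $$\frac{d\tilde k_i}{dt}=-(L_i(\tilde k)-\hat L_i)\,\tilde k_i,\qquad i\in I,$$ in which $\tilde k\in\mathbb{R}_{>0}^I$ is extended by $0$ to $F\setminus I$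 when $L_i$ is evaluated, has a unique solution; it exists for all $t\in[0,\infty)$, and, extended by $0$ to $F\setminus I$, it converges to $\hat k$ as $t\to+\infty$. -/

import Mathlib

open Set Filter Topology

noncomputable section

/-! ### Cellular decompositions of a surface -/

/-- The point of parameter `t ∈ [0,1]` on the `j`-th of the `n` equal arcs (the sides of the `n`-gon)
of the unit circle. -/
def polygonArc (n : ℕ) (j : Fin n) (t : ℝ) : ℂ :=
  Complex.exp (2 * (Real.pi : ℂ) * Complex.I * (((j : ℕ) : ℂ) + (t : ℂ)) / (n : ℂ))

/-- A cellular decomposition of a closed surface `S` with sets of `0`-, `1`- and `2`-cells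
`V`, `E`, `F`. The closed `2`-cells are images of polygons (the closed unit disk whose boundary
circle is divided into `n ≥ 1` sides), every side is mapped along an edge, and every edge `e` has
two sides, indexed by `(e, false)` and `(e, true)`; the faces at the two sides of an edge, or two
sides of one polygon, are allowed to coincide, and so are the two endpoints of an edge. -/
structure CellularDecomposition (S V E F : Type*) [TopologicalSpace S] where
  /-- the `0`-cells -/
  vertex : V → S
  /-- parametrizations of the closed edges by `[0,1]` -/
  edgeMap : E → ℝ → S
  /-- parametrizations of the closed faces by the closed unit disk -/
  faceMap : F → ℂ → S
  /-- the number of sides of a face -/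
  numSides : F → ℕ
  numSides_pos : ∀ f, 0 < numSides f
  /-- the two sides of an edge are sides of polygons, and every side of a polygon arises once -/
  side : E × Bool ≃ (Σ f : F, Fin (numSides f))
  /-- whether the polygon runs along the edge against the parametrization of the edge -/
  reversed : E × Bool → Bool
  continuousOn_edge : ∀ e, ContinuousOn (edgeMap e) (Icc 0 1)
  continuousOn_face : ∀ f, ContinuousOn (faceMap f) (Metric.closedBall 0 1)
  injOn_edge : ∀ e, InjOn (edgeMap e) (Ioo 0 1)
  injOn_face : ∀ f, InjOn (faceMap f) (Metric.ball 0 1)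
  edge_zero : ∀ e, edgeMap e 0 ∈ range vertex
  edge_one : ∀ e, edgeMap e 1 ∈ range vertex
  face_boundary : ∀ s : E × Bool, ∀ t ∈ Icc (0 : ℝ) 1,
    faceMap (side s).1 (polygonArc (numSides (side s).1) (side s).2 t) =
      edgeMap s.1 (if reversed s then 1 - t else t)
  /-- `S` is the disjoint union of the vertices, the open edges and the open faces -/
  partition : ∀ x : S, ∃! c : V ⊕ E ⊕ F,
    x ∈ Sum.elim (fun v => {vertex v})
      (Sum.elim (fun e => edgeMap e '' Ioo 0 1) (fun f => faceMap f '' Metric.ball 0 1)) c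

namespace CellularDecomposition

variable {S V E F : Type*} [TopologicalSpace S]

/-- The face at a given side of an edge. -/
def face (D : CellularDecomposition S V E F) (s : E × Bool) : F := (D.side s).1

open scoped Classical in
/-- `E_{F'}`: the edges on the boundary of some face of `F'`. -/
def edgesOf [Fintype E] (D : CellularDecomposition S V E F) (F' : Finset F) : Finset E :=
  {e | ∃ f ∈ F', ∃ b : Bool, D.face (e, b) = f}

end CellularDecomposition

/-! ### Spherical bigons -/

/-- The radius `r ∈ (0, π/2]` with `cot r = k`, for `k ≥ 0`. -/
def radius (k : ℝ) : ℝ := Real.pi / 2 - Real.arctan k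

theorem cot_radius (k : ℝ) : Real.cos (radius k) / Real.sin (radius k) = k := by
  rw [radius, Real.cos_pi_div_two_sub, Real.sin_pi_div_two_sub, ← Real.tan_eq_sin_div_cos,
    Real.tan_arctan]

/-- The open disk in the unit sphere `𝕊²` with centre `p` and radius `r`; the distance of two
points of the sphere is the angle between them. -/
def sphericalDisk (p : EuclideanSpace ℝ (Fin 3)) (r : ℝ) : Set (EuclideanSpace ℝ (Fin 3)) :=
  {y | ‖y‖ = 1 ∧ InnerProductGeometry.angle p y < r}

/-- The centre of the first disk of the bigon. The bigon is placed with one corner at `(0,0,1)`;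
there the boundary circle of the first disk has inward unit normal `(1,0,0)`, and the centre is
reached from the corner in this direction along a geodesic of length `r`. -/
def centerOne (r : ℝ) : EuclideanSpace ℝ (Fin 3) :=
  Real.cos r • !₂[(0 : ℝ), 0, 1] + Real.sin r • !₂[(1 : ℝ), 0, 0]

/-- The centre of the second disk of the bigon. At the corner `(0,0,1)` its boundary circle has
inward unit normal `(-cos φ, sin φ, 0)`, which makes the angle `π - φ` with that of the first disk,
so that the interior angle of the intersection of the disks is `φ`. -/
def centerTwo (φ r : ℝ) : EuclideanSpace ℝ (Fin 3) :=
  Real.cos r • !₂[(0 : ℝ), 0, 1] + Real.sin r • !₂[-Real.cos φ, Real.sin φ, 0]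

/-- The boundary circle of the first disk, parametrized by the angle at its centre, starting at the
corner `(0,0,1)`. -/
def circleOne (r θ : ℝ) : EuclideanSpace ℝ (Fin 3) :=
  Real.cos r • centerOne r +
    Real.sin r • (Real.cos θ • !₂[-Real.cos r, 0, Real.sin r] + Real.sin θ • !₂[(0 : ℝ), 1, 0])

/-- The length of the side on the boundary of the first disk of the bigon of angle `φ` that is
formed by disks of radii `r₁` and `r₂`: the arc length of the part of the first circle that lies in
the second disk. (By reflection, the other side has length `bigonSideLength φ r₂ r₁`.) -/
def bigonSideLength (φ r₁ r₂ : ℝ) : ℝ :=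
  ∫ θ in {θ ∈ Ioc (-Real.pi) Real.pi | circleOne r₁ θ ∈ sphericalDisk (centerTwo φ r₂) r₂},
    ‖deriv (circleOne r₁) θ‖

/-- The total geodesic curvature `ℓ₁ k₁` of the side, of geodesic curvature `k₁`, of the bigon of
angle `φ` formed by disks with boundary curvatures `k₁` and `k₂`. -/
def sideCurvature (φ k₁ k₂ : ℝ) : ℝ := bigonSideLength φ (radius k₁) (radius k₂) * k₁

/-! ### Metrics, total geodesic curvatures and the flow -/

variable {S V E F : Type*} [TopologicalSpace S]

/-- The total geodesic curvature `L_f` of the face `f` for the spherical conical metric with weight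
`Φ` and geodesic curvatures `k`: the sum over the sides of `f` of the total geodesic curvature of the
corresponding side of the bigon of the edge. -/
def totalCurvature (D : CellularDecomposition S V E F) (Φ : E → ℝ) (k : F → ℝ) (f : F) : ℝ :=
  ∑ j : Fin (D.numSides f),
    sideCurvature (Φ (D.side.symm ⟨f, j⟩).1) (k f)
      (k (D.face ((D.side.symm ⟨f, j⟩).1, !(D.side.symm ⟨f, j⟩).2)))

/-- Degenerated circle pattern metrics, encoded by the geodesic curvatures of the circles. -/
def IsDegeneratedMetric (k : F → ℝ) : Prop := (∀ f, 0 ≤ k f) ∧ ∃ f, k f = 0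

/-- The vectors that are positive on the faces of `I` and zero on the others. -/
def positiveOn (I : Finset F) : Set (F → ℝ) :=
  {k | (∀ f ∈ I, 0 < k f) ∧ ∀ f ∉ I, k f = 0}

/-- The admissible prescribed total geodesic curvatures supported exactly on `I`. -/
def prescribable [Fintype E] (D : CellularDecomposition S V E F) (Φ : E → ℝ) (I : Finset F) :
    Set (F → ℝ) :=
  {L | L ∈ positiveOn I ∧ ∀ F' ⊆ I, F'.Nonempty → ∑ f ∈ F', L f < 2 * ∑ e ∈ D.edgesOf F', Φ e}

open scoped Classical in
/-- Extension by zero of curvatures given on the faces of `I`. -/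
def extendZero (I : Finset F) (k : I → ℝ) : F → ℝ :=
  fun f => if h : f ∈ I then k ⟨f, h⟩ else 0

/-- `k` solves, on the time interval `J`, the reduced prescribed combinatorial Ricci flow
`dkᵢ/dt = -(Lᵢ(k) - L̂ᵢ) kᵢ`, `i ∈ I`, in the space of positive curvatures on `I`; the curvatures
are `0` on the other faces. -/
def IsFlowSolution (D : CellularDecomposition S V E F) (Φ : E → ℝ) (I : Finset F) (Lhat : F → ℝ)
    (J : Set ℝ) (k : ℝ → I → ℝ) : Prop :=
  ∀ t ∈ J, ∀ i : I, 0 < k t i ∧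
    HasDerivWithinAt (fun s => k s i)
      (-(totalCurvature D Φ (extendZero I (k t)) i - Lhat i) * k t i) J t

end

/-!
The boundary circle of a disk of curvature `a` meets the disk of curvature `b` in an arc starting
at a corner of the bigon, which yields the closed form
`L_φ(a, b) = sin α (π - 2 arctan ((sin α cos φ + b cos α) / sin φ))` with `α = arctan a`. It is
decreasing in `b` and strictly increasing under a common scaling of `a` and `b`. Hence, in the
coordinates `u = log k`, the total geodesic curvature `L(u)` of the faces of `I` is off-diagonally
antitone and strictly increasing along the constant vector.

Comparing `u` with `v + c` at a coordinate where `u - v` is maximal shows that such a map is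
injective and, by a maximum principle with an exponential barrier, that every solution of
`du/dt = L(v) - L(u)` converges to `v`. A solution of `L(u) = L̂` is found as a subsolution
`L(u) ≤ L̂` with the largest coordinate sum. It exists because the subsolutions above a fixed one
are bounded: along an ultrafilter on which exactly the curvatures of a set `F'` of faces tend to
infinity, the two sides of an edge interior to `F'` together contribute at least `2 Φ(e)` in the
limit, and the side in `F'` of a boundary edge contributes `2 Φ(e)`, so that
`∑_{f ∈ F'} L_f` is asymptotically at least `2 ∑_{e ∈ E_{F'}} Φ(e)`, against `L̂ ∈ 𝓛_I`. Finally the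
flow field is smooth and bounded in `u`, hence complete.
-/

noncomputable section

open Real MeasureTheory

/-! ### Sides of bigons -/

theorem sin_radius (k : ℝ) : sin (radius k) = cos (arctan k) := sin_pi_div_two_sub _

theorem cos_radius (k : ℝ) : cos (radius k) = sin (arctan k) := cos_pi_div_two_sub _

theorem radius_mem_Ioo (k : ℝ) : radius k ∈ Ioo 0 π := by
  constructor <;> unfold radius <;>
    linarith [arctan_lt_pi_div_two k, neg_pi_div_two_lt_arctan k]

theorem hasDerivAt_circleOne (r θ : ℝ) :
    HasDerivAt (circleOne r)
      (sin r • (-sin θ • !₂[-cos r, 0, sin r] + cos θ • !₂[(0 : ℝ), 1, 0])) θ := by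
  unfold circleOne
  exact ((((hasDerivAt_cos θ).smul_const !₂[-cos r, 0, sin r]).add
    ((hasDerivAt_sin θ).smul_const !₂[(0 : ℝ), 1, 0])).const_smul (sin r)).const_add _

theorem norm_deriv_circleOne {r : ℝ} (hr : 0 ≤ sin r) (θ : ℝ) :
    ‖deriv (circleOne r) θ‖ = sin r := by
  have hunit : ‖-sin θ • !₂[-cos r, 0, sin r] + cos θ • !₂[(0 : ℝ), 1, 0]‖ = 1 := by
    rw [EuclideanSpace.norm_eq, sqrt_eq_one]
    simp only [Fin.sum_univ_three, norm_eq_abs, sq_abs, PiLp.add_apply, PiLp.smul_apply,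
      Matrix.cons_val, smul_eq_mul]
    linear_combination sin θ ^ 2 * sin_sq_add_cos_sq r + sin_sq_add_cos_sq θ
  rw [(hasDerivAt_circleOne r θ).deriv, norm_smul, norm_of_nonneg hr, hunit, mul_one]

theorem norm_circleOne (r θ : ℝ) : ‖circleOne r θ‖ = 1 := by
  rw [EuclideanSpace.norm_eq, sqrt_eq_one]
  simp only [Fin.sum_univ_three, norm_eq_abs, sq_abs, circleOne, centerOne, PiLp.add_apply,
    PiLp.smul_apply, Matrix.cons_val, smul_eq_mul]
  grind [sin_sq_add_cos_sq r, sin_sq_add_cos_sq θ]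

theorem norm_centerTwo (φ r : ℝ) : ‖centerTwo φ r‖ = 1 := by
  rw [EuclideanSpace.norm_eq, sqrt_eq_one]
  simp only [Fin.sum_univ_three, norm_eq_abs, sq_abs, centerTwo, PiLp.add_apply,
    PiLp.smul_apply, Matrix.cons_val, smul_eq_mul]
  linear_combination sin r ^ 2 * sin_sq_add_cos_sq φ + sin_sq_add_cos_sq r

theorem inner_centerTwo_circleOne (φ r₁ r₂ θ : ℝ) :
    inner ℝ (centerTwo φ r₂) (circleOne r₁ θ) - cos r₂ =
      sin r₁ * (sin r₂ * sin φ * sin θ -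
        (1 - cos θ) * (cos r₁ * sin r₂ * cos φ + cos r₂ * sin r₁)) := by
  simp only [PiLp.inner_apply, Fin.sum_univ_three, circleOne, centerOne, centerTwo,
    PiLp.add_apply, PiLp.smul_apply, Matrix.cons_val, smul_eq_mul, RCLike.inner_apply,
    ringHom_apply]
  linear_combination cos r₂ * sin_sq_add_cos_sq r₁

theorem mem_sphericalDisk_iff {p y : EuclideanSpace ℝ (Fin 3)} {r : ℝ} (hp : ‖p‖ = 1)
    (hy : ‖y‖ = 1) (hr : r ∈ Icc 0 π) : y ∈ sphericalDisk p r ↔ cos r < inner ℝ p y := by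
  have hcos := InnerProductGeometry.cos_angle p y
  rw [hp, hy, mul_one, div_one] at hcos
  rw [← hcos, strictAntiOn_cos.lt_iff_gt hr
    ⟨InnerProductGeometry.angle_nonneg p y, InnerProductGeometry.angle_le_pi p y⟩]
  exact and_iff_right hy

theorem circleOne_mem_sphericalDisk_iff {φ r₁ r₂ θ : ℝ} (h₁ : 0 < sin r₁) (h₂ : r₂ ∈ Icc 0 π) :
    circleOne r₁ θ ∈ sphericalDisk (centerTwo φ r₂) r₂ ↔
      (1 - cos θ) * (cos r₁ * sin r₂ * cos φ + cos r₂ * sin r₁) <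
        sin r₂ * sin φ * sin θ := by
  rw [mem_sphericalDisk_iff (norm_centerTwo φ r₂) (norm_circleOne r₁ θ) h₂, ← sub_pos,
    inner_centerTwo_circleOne, mul_pos_iff_of_pos_left h₁, sub_pos]

theorem one_sub_cos_mul_lt_mul_sin_iff {c s θ : ℝ} (hs : 0 < s) (hθ : θ ∈ Ioc 0 (2 * π)) :
    (1 - cos θ) * c < s * sin θ ↔ θ < π - 2 * arctan (c / s) := by
  rcases hθ.2.eq_or_lt with rfl | hlt
  · simpa using show π - 2 * arctan (c / s) ≤ 2 * π by
      linarith [neg_pi_div_two_lt_arctan (c / s)]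
  have hsin : 0 < sin (θ / 2) := sin_pos_of_pos_of_lt_pi (by linarith [hθ.1]) (by linarith)
  have half : sin θ = 2 * sin (θ / 2) * cos (θ / 2) ∧ 1 - cos θ = 2 * sin (θ / 2) ^ 2 := by
    have hs₂ := sin_two_mul (θ / 2)
    have hc₂ := cos_two_mul (θ / 2)
    rw [mul_div_cancel₀ θ two_ne_zero] at hs₂ hc₂
    exact ⟨hs₂, by rw [hc₂, cos_sq']; ring⟩
  calc (1 - cos θ) * c < s * sin θ
      ↔ 2 * sin (θ / 2) * (c * sin (θ / 2)) < 2 * sin (θ / 2) * (cos (θ / 2) * s) := by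
        rw [half.1, half.2]; ring_nf
    _ ↔ c / s < tan (π / 2 - θ / 2) := by
        rw [mul_lt_mul_iff_right₀ (by positivity), tan_eq_sin_div_cos, sin_pi_div_two_sub,
          cos_pi_div_two_sub, div_lt_div_iff₀ hs hsin]
    _ ↔ arctan (c / s) < π / 2 - θ / 2 := by
        rw [← arctan_lt_arctan_iff, arctan_tan (by linarith) (by linarith [hθ.1])]
    _ ↔ θ < π - 2 * arctan (c / s) := by constructor <;> intro h <;> linarith

theorem setIntegral_Ioc_neg_pi_pi_inter {P : Set ℝ} (hP : MeasurableSet P)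
    (hper : ∀ θ, θ + 2 * π ∈ P ↔ θ ∈ P) (c : ℝ) :
    ∫ _ in Ioc (-π) π ∩ P, c = ∫ _ in Ioc 0 (2 * π) ∩ P, c := by
  have periodic : Function.Periodic (P.indicator fun _ => c) (2 * π) := fun θ =>
    indicator_eq_indicator (hper θ) rfl
  have h := periodic.intervalIntegral_add_eq (-π) 0
  rwa [intervalIntegral.integral_of_le (by linarith [pi_pos]),
    intervalIntegral.integral_of_le (by linarith [pi_pos]), setIntegral_indicator hP,
    setIntegral_indicator hP, zero_add, show -π + 2 * π = π by ring] at h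

theorem bigonSideLength_eq {φ r₁ r₂ : ℝ} (hφ : φ ∈ Ioo 0 π) (h₁ : r₁ ∈ Ioo 0 π)
    (h₂ : r₂ ∈ Ioo 0 π) :
    bigonSideLength φ r₁ r₂ =
      sin r₁ * (π - 2 * arctan
        ((cos r₁ * sin r₂ * cos φ + cos r₂ * sin r₁) / (sin r₂ * sin φ))) := by
  set c := cos r₁ * sin r₂ * cos φ + cos r₂ * sin r₁
  set s := sin r₂ * sin φ
  have sin_pos : 0 < sin r₁ := sin_pos_of_mem_Ioo h₁
  have s_pos : 0 < s := mul_pos (sin_pos_of_mem_Ioo h₂) (sin_pos_of_mem_Ioo hφ)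
  have arctan_bounds := arctan_mem_Ioo (c / s)
  set P : Set ℝ := {θ | circleOne r₁ θ ∈ sphericalDisk (centerTwo φ r₂) r₂}
  have mem_P (θ : ℝ) : θ ∈ P ↔ (1 - cos θ) * c < s * sin θ :=
    circleOne_mem_sphericalDisk_iff sin_pos (Ioo_subset_Icc_self h₂)
  have measurable_P : MeasurableSet P := by
    rw [show P = {θ | (1 - cos θ) * c < s * sin θ} from Set.ext mem_P]
    exact (isOpen_lt (by fun_prop) (by fun_prop)).measurableSet
  have arc : Ioc 0 (2 * π) ∩ P = Ioo 0 (π - 2 * arctan (c / s)) := by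
    ext θ
    rw [mem_inter_iff, mem_P]
    constructor
    · exact fun h => ⟨h.1.1, (one_sub_cos_mul_lt_mul_sin_iff s_pos h.1).1 h.2⟩
    · intro h
      have hθ : θ ∈ Ioc 0 (2 * π) := ⟨h.1, by linarith [h.2, arctan_bounds.1]⟩
      exact ⟨hθ, (one_sub_cos_mul_lt_mul_sin_iff s_pos hθ).2 h.2⟩
  calc bigonSideLength φ r₁ r₂
      = ∫ _ in Ioc (-π) π ∩ P, sin r₁ := by
        simp only [bigonSideLength, norm_deriv_circleOne sin_pos.le]; rfl
    _ = ∫ _ in Ioo 0 (π - 2 * arctan (c / s)), sin r₁ := by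
        rw [setIntegral_Ioc_neg_pi_pi_inter measurable_P
          fun θ => by simp only [mem_P, cos_add_two_pi, sin_add_two_pi], arc]
    _ = sin r₁ * (π - 2 * arctan (c / s)) := by
        rw [setIntegral_const, volume_real_Ioo_of_le (by linarith [arctan_bounds.2]), smul_eq_mul,
          sub_zero, mul_comm]

theorem sin_mul_cos_lt_self {x : ℝ} (hx : 0 < x) : sin x * cos x < x := by
  have h := sin_lt (x := 2 * x) (by linarith)
  rw [sin_two_mul] at h
  linarith

theorem tendsto_sin_arctan_atTop : Tendsto (fun x : ℝ => sin (arctan x)) atTop (𝓝 1) := by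
  simpa [Function.comp_def] using
    (continuous_sin.tendsto _).comp (tendsto_arctan_atTop.mono_right nhdsWithin_le_nhds)

theorem tendsto_cos_arctan_atTop : Tendsto (fun x : ℝ => cos (arctan x)) atTop (𝓝 0) := by
  simpa [Function.comp_def] using
    (continuous_cos.tendsto _).comp (tendsto_arctan_atTop.mono_right nhdsWithin_le_nhds)

theorem div_one_add_sq_lt_pi_div_two_sub_arctan (y : ℝ) :
    y / (1 + y ^ 2) < π / 2 - arctan y := by
  have h := sin_mul_cos_lt_self (sub_pos.2 (arctan_lt_pi_div_two y))
  rw [sin_pi_div_two_sub, cos_pi_div_two_sub, ← tan_mul_cos (cos_arctan_pos y).ne', tan_arctan] at h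
  convert h using 1
  rw [mul_left_comm, ← pow_two, cos_sq_arctan, mul_one_div]

theorem strictMono_mul_pi_div_two_sub_arctan (c : ℝ) :
    StrictMono fun x : ℝ => x * (π / 2 - arctan (c * x)) := by
  refine strictMono_of_hasDerivAt_pos (fun x => (hasDerivAt_id x).mul
    ((((hasDerivAt_id x).const_mul c).arctan).const_sub (π / 2))) fun x => ?_
  have h := div_one_add_sq_lt_pi_div_two_sub_arctan (c * x)
  simp only [id_eq] at h ⊢
  rw [show x * -(1 / (1 + (c * x) ^ 2) * (c * 1)) = -(c * x / (1 + (c * x) ^ 2)) by ring]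
  linarith

theorem mul_pi_div_two_sub_arctan_le {x : ℝ} (hx : x ∈ Ioc 0 1) (c : ℝ) :
    x * (π / 2 - arctan c) ≤ π / 2 - arctan (c * x) := by
  have mono : Monotone fun y : ℝ => arctan (y * x) - x * arctan y := by
    refine monotone_of_hasDerivAt_nonneg (fun y =>
      (((hasDerivAt_id y).mul_const x).arctan).sub ((hasDerivAt_arctan y).const_mul x)) fun y => ?_
    have h : (y * x) ^ 2 ≤ y ^ 2 := by
      rw [mul_pow]
      exact mul_le_of_le_one_right (sq_nonneg y) (pow_le_one₀ hx.1.le hx.2)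
    have : 1 / (1 + y ^ 2) ≤ 1 / (1 + (y * x) ^ 2) := by gcongr
    simp only [id_eq, Pi.zero_apply]
    nlinarith [mul_le_mul_of_nonneg_left this hx.1.le]
  have arctan_lim := tendsto_arctan_atTop.mono_right nhdsWithin_le_nhds
  have lim : Tendsto (fun y : ℝ => arctan (y * x) - x * arctan y) atTop
      (𝓝 (π / 2 - x * (π / 2))) :=
    (arctan_lim.comp (tendsto_id.atTop_mul_const hx.1)).sub (arctan_lim.const_mul x)
  linarith [mono.ge_of_tendsto lim c]

theorem arctan_cos_div_sin {φ : ℝ} (hφ : φ ∈ Ioo 0 π) : arctan (cos φ / sin φ) = π / 2 - φ :=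
  arctan_eq_of_tan_eq (by rw [tan_eq_sin_div_cos, sin_pi_div_two_sub, cos_pi_div_two_sub])
    ⟨by linarith [hφ.2], by linarith [hφ.1]⟩

theorem arctan_add_arctan_inv {φ t : ℝ} (hφ : φ ∈ Ioo 0 π) (ht : 0 < t) :
    arctan ((cos φ + t) / sin φ) + arctan ((cos φ + t⁻¹) / sin φ) = π - φ := by
  have hs : 0 < sin φ := sin_pos_of_mem_Ioo hφ
  set w := arctan ((cos φ + t) / sin φ) with hw
  have w_gt : π / 2 - φ < w := by
    rw [← arctan_cos_div_sin hφ, hw, arctan_lt_arctan_iff]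
    gcongr
    linarith
  have hcos : 0 < cos w := cos_arctan_pos _
  have hsin : sin w = (cos φ + t) / sin φ * cos w := by
    rw [← tan_mul_cos hcos.ne', hw, tan_arctan]
  have sin_add_w : sin (φ + w) = (1 + t * cos φ) / sin φ * cos w := by
    rw [sin_add, hsin]
    field_simp
    linear_combination sin_sq_add_cos_sq φ
  have cos_add_w : cos (φ + w) = -(t * cos w) := by
    rw [cos_add, hsin]
    field_simp
    ring
  have htan : tan (π - φ - w) = (cos φ + t⁻¹) / sin φ := by
    rw [sub_sub, tan_pi_sub, tan_eq_sin_div_cos, sin_add_w, cos_add_w]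
    field_simp
    ring
  rw [arctan_eq_of_tan_eq htan ⟨by linarith [hφ.2, arctan_lt_pi_div_two ((cos φ + t) / sin φ)],
    by linarith⟩]
  ring

theorem sideCurvature_eq {φ : ℝ} (hφ : φ ∈ Ioo 0 π) (a b : ℝ) :
    sideCurvature φ a b = sin (arctan a) *
      (π - 2 * arctan ((sin (arctan a) * cos φ + b * cos (arctan a)) / sin φ)) := by
  have : 0 < cos (arctan b) := cos_arctan_pos b
  have sin_eq (x : ℝ) : sin (arctan x) = x * cos (arctan x) := by
    rw [← tan_mul_cos (cos_arctan_pos x).ne', tan_arctan]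
  have hs := (sin_pos_of_mem_Ioo hφ).ne'
  rw [sideCurvature, bigonSideLength_eq hφ (radius_mem_Ioo a) (radius_mem_Ioo b), cos_radius,
    cos_radius, sin_radius, sin_radius,
    show (sin (arctan a) * cos (arctan b) * cos φ + sin (arctan b) * cos (arctan a)) /
      (cos (arctan b) * sin φ) = (sin (arctan a) * cos φ + b * cos (arctan a)) / sin φ by
        rw [sin_eq b]; field_simp]
  rw [mul_right_comm, mul_comm _ a, ← sin_eq]

theorem sideCurvature_eq_of_ne_zero {φ a : ℝ} (hφ : φ ∈ Ioo 0 π) (ha : a ≠ 0) (b : ℝ) :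
    sideCurvature φ a b =
      2 * (sin (arctan a) * (π / 2 - arctan ((cos φ + b / a) / sin φ * sin (arctan a)))) := by
  have hcos : b * cos (arctan a) = b / a * sin (arctan a) := by
    rw [← tan_mul_cos (cos_arctan_pos a).ne', tan_arctan]; field_simp
  rw [sideCurvature_eq hφ, hcos]
  ring_nf

theorem bigonSideLength_pos {φ r₁ r₂ : ℝ} (hφ : φ ∈ Ioo 0 π) (h₁ : r₁ ∈ Ioo 0 π)
    (h₂ : r₂ ∈ Ioo 0 π) : 0 < bigonSideLength φ r₁ r₂ := by
  rw [bigonSideLength_eq hφ h₁ h₂]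
  refine mul_pos (sin_pos_of_mem_Ioo h₁) ?_
  linarith [arctan_lt_pi_div_two
    ((cos r₁ * sin r₂ * cos φ + cos r₂ * sin r₁) / (sin r₂ * sin φ))]

theorem contDiff_sideCurvature {φ : ℝ} (hφ : φ ∈ Ioo 0 π) {n : WithTop ℕ∞} :
    ContDiff ℝ n fun p : ℝ × ℝ => sideCurvature φ p.1 p.2 := by
  simp only [sideCurvature_eq hφ]
  have hs : ContDiff ℝ n fun p : ℝ × ℝ => sin (arctan p.1) :=
    contDiff_sin.comp (contDiff_arctan.comp contDiff_fst)
  have hc : ContDiff ℝ n fun p : ℝ × ℝ => cos (arctan p.1) :=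
    contDiff_cos.comp (contDiff_arctan.comp contDiff_fst)
  exact hs.mul (contDiff_const.sub (contDiff_const.mul (contDiff_arctan.comp
    (((hs.mul contDiff_const).add (contDiff_snd.mul hc)).div_const _))))

theorem abs_sideCurvature_le {φ : ℝ} (hφ : φ ∈ Ioo 0 π) (a b : ℝ) :
    |sideCurvature φ a b| ≤ 2 * π := by
  rw [sideCurvature_eq hφ, abs_mul]
  set y := (sin (arctan a) * cos φ + b * cos (arctan a)) / sin φ
  have h : |π - 2 * arctan y| ≤ 2 * π := by
    rw [abs_le]
    constructor <;> linarith [pi_pos, arctan_lt_pi_div_two y, neg_pi_div_two_lt_arctan y]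
  nlinarith [abs_sin_le_one (arctan a), abs_nonneg (π - 2 * arctan y)]

theorem antitone_sideCurvature {φ a : ℝ} (hφ : φ ∈ Ioo 0 π) (ha : 0 ≤ a) :
    Antitone (sideCurvature φ a) := by
  intro b b' h
  have hs := sin_pos_of_mem_Ioo hφ
  have := cos_arctan_pos a
  rw [sideCurvature_eq hφ, sideCurvature_eq hφ]
  gcongr

theorem sideCurvature_lt_sideCurvature_mul {φ a t : ℝ} (hφ : φ ∈ Ioo 0 π) (ha : 0 < a) (b : ℝ)
    (ht : 1 < t) : sideCurvature φ a b < sideCurvature φ (t * a) (t * b) := by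
  have ht₀ : t ≠ 0 := by positivity
  rw [sideCurvature_eq_of_ne_zero hφ ha.ne', sideCurvature_eq_of_ne_zero hφ (by positivity),
    mul_div_mul_left _ _ ht₀]
  gcongr 2 * ?_
  exact strictMono_mul_pi_div_two_sub_arctan _ (sin_arctan_strictMono (lt_mul_of_one_lt_left ha ht))

theorem sq_sin_arctan_mul_le_sideCurvature {φ a : ℝ} (hφ : φ ∈ Ioo 0 π) (ha : 0 < a) (b : ℝ) :
    sin (arctan a) ^ 2 * (π - 2 * arctan ((cos φ + b / a) / sin φ)) ≤ sideCurvature φ a b := by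
  have hx : sin (arctan a) ∈ Ioc 0 1 := ⟨sin_arctan_pos.2 ha, sin_le_one _⟩
  have h := mul_le_mul_of_nonneg_left
    (mul_pi_div_two_sub_arctan_le hx ((cos φ + b / a) / sin φ)) hx.1.le
  rw [sideCurvature_eq_of_ne_zero hφ ha.ne']
  linarith

theorem sq_min_sin_arctan_mul_le_sideCurvature_add {φ a b : ℝ} (hφ : φ ∈ Ioo 0 π) (ha : 0 < a)
    (hb : 0 < b) :
    min (sin (arctan a)) (sin (arctan b)) ^ 2 * (2 * φ) ≤
      sideCurvature φ a b + sideCurvature φ b a := by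
  set m := min (sin (arctan a)) (sin (arctan b))
  have : 0 ≤ m := le_min (sin_arctan_nonneg.2 ha.le) (sin_arctan_nonneg.2 hb.le)
  have angles := arctan_add_arctan_inv hφ (div_pos hb ha)
  rw [inv_div] at angles
  have arccot_nonneg (y : ℝ) : 0 ≤ π - 2 * arctan y := by linarith [arctan_lt_pi_div_two y]
  calc m ^ 2 * (2 * φ)
      = m ^ 2 * (π - 2 * arctan ((cos φ + b / a) / sin φ)) +
        m ^ 2 * (π - 2 * arctan ((cos φ + a / b) / sin φ)) := by
        linear_combination 2 * m ^ 2 * angles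
    _ ≤ sin (arctan a) ^ 2 * (π - 2 * arctan ((cos φ + b / a) / sin φ)) +
        sin (arctan b) ^ 2 * (π - 2 * arctan ((cos φ + a / b) / sin φ)) := by
        gcongr
        · exact arccot_nonneg _
        · exact min_le_left _ _
        · exact arccot_nonneg _
        · exact min_le_right _ _
    _ ≤ sideCurvature φ a b + sideCurvature φ b a :=
        add_le_add (sq_sin_arctan_mul_le_sideCurvature hφ ha b)
          (sq_sin_arctan_mul_le_sideCurvature hφ hb a)

theorem eventually_mul_le_sideCurvature_add {α : Type*} {l : Filter α} {φ c : ℝ} {a b : α → ℝ}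
    (hφ : φ ∈ Ioo 0 π) (hc : c < 1) (ha : Tendsto a l atTop) (hb : Tendsto b l atTop) :
    ∀ᶠ x in l, c * (2 * φ) ≤ sideCurvature φ (a x) (b x) + sideCurvature φ (b x) (a x) := by
  have lim : Tendsto (fun x => min (sin (arctan (a x))) (sin (arctan (b x))) ^ 2) l (𝓝 1) := by
    simpa using ((tendsto_sin_arctan_atTop.comp ha).min (tendsto_sin_arctan_atTop.comp hb)).pow 2
  filter_upwards [lim.eventually_const_le hc, ha.eventually_gt_atTop 0, hb.eventually_gt_atTop 0]
    with x hx hax hbx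
  exact (mul_le_mul_of_nonneg_right hx (by linarith [hφ.1])).trans
    (sq_min_sin_arctan_mul_le_sideCurvature_add hφ hax hbx)

theorem tendsto_sideCurvature {α : Type*} {l : Filter α} {φ β : ℝ} {a b : α → ℝ}
    (hφ : φ ∈ Ioo 0 π) (ha : Tendsto a l atTop) (hb : Tendsto b l (𝓝 β)) :
    Tendsto (fun x => sideCurvature φ (a x) (b x)) l (𝓝 (2 * φ)) := by
  have hsin := tendsto_sin_arctan_atTop.comp ha
  have slope : Tendsto
      (fun x => (sin (arctan (a x)) * cos φ + b x * cos (arctan (a x))) / sin φ) l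
      (𝓝 (cos φ / sin φ)) := by
    simpa using
      ((hsin.mul_const (cos φ)).add (hb.mul (tendsto_cos_arctan_atTop.comp ha))).div_const (sin φ)
  have angle := (continuous_arctan.tendsto _).comp slope
  have lim := hsin.mul ((angle.const_mul 2).const_sub π)
  rw [arctan_cos_div_sin hφ, show 1 * (π - 2 * (π / 2 - φ)) = 2 * φ by ring] at lim
  simp only [sideCurvature_eq hφ]
  exact lim

/-! ### M-functions and their flows -/

section Barrier

variable {ι : Type*} [Finite ι]

theorem eventually_lt_of_hasDerivWithinAt_neg {f : ℝ → ℝ} {f' t : ℝ}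
    (hf : HasDerivWithinAt f f' (Ioi t) t) (hf' : f' < 0) : ∀ᶠ s in 𝓝[>] t, f s < f t := by
  have slope_lim := (hasDerivWithinAt_iff_tendsto_slope' self_notMem_Ioi).1 hf
  filter_upwards [slope_lim.eventually_lt_const hf', self_mem_nhdsWithin] with s hslope hs
  rwa [slope_def_field, div_lt_iff₀ (sub_pos.2 hs), zero_mul, sub_neg] at hslope

theorem le_zero_of_forall_deriv_neg {w w' : ℝ → ι → ℝ}
    (hw : ∀ t, 0 ≤ t → HasDerivWithinAt w (w' t) (Ici 0) t) (h₀ : w 0 ≤ 0)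
    (hneg : ∀ t, 0 ≤ t → w t ≤ 0 → ∀ i, w t i = 0 → w' t i < 0) {t : ℝ} (ht : 0 ≤ t) :
    w t ≤ 0 := by
  cases nonempty_fintype ι
  have hcont : ContinuousOn w (Icc 0 t) := fun s hs =>
    (hw s hs.1).continuousWithinAt.mono Icc_subset_Ici_self
  have hclosed : IsClosed ({s | w s ≤ 0} ∩ Icc 0 t) := by
    rw [inter_comm]
    exact hcont.preimage_isClosed_of_isClosed isClosed_Icc isClosed_Iic
  refine (hclosed.Icc_subset_of_forall_exists_gt h₀ ?_ : Icc 0 t ⊆ _) ⟨ht, le_rfl⟩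
  rintro s ⟨hs, hs₀⟩ y hy
  have hev : ∀ᶠ r in 𝓝[>] s, w r ≤ 0 := by
    refine eventually_all.2 fun i => ?_
    have hwi := hasDerivWithinAt_pi.1
      ((hw s hs₀.1).mono (Ioi_subset_Ici hs₀.1)) i
    rcases (hs i).lt_or_eq with hlt | heq
    · exact (hwi.continuousWithinAt.eventually_lt_const hlt).mono fun r => le_of_lt
    · exact (eventually_lt_of_hasDerivWithinAt_neg hwi (hneg s hs₀.1 hs i heq)).mono
        fun r hr => hr.le.trans heq.le
  obtain ⟨r, hr, hr'⟩ := (hev.and (Ioc_mem_nhdsGT hy)).exists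
  exact ⟨r, hr, hr'⟩

theorem eventually_le_of_max_deriv_le {w w' : ℝ → ι → ℝ} {ε δ : ℝ}
    (hw : ∀ t, 0 ≤ t → HasDerivWithinAt w (w' t) (Ici 0) t) (hδ : 0 < δ)
    (hmax : ∀ t, 0 ≤ t → ∀ i, (∀ j, w t j ≤ w t i) → ε ≤ w t i → w' t i ≤ -δ) {η : ℝ}
    (hη : ε < η) : ∀ᶠ t in atTop, ∀ i, w t i ≤ η := by
  cases nonempty_fintype ι
  set M := ‖fun i => w 0 i - ε‖
  have hM : 0 ≤ M := norm_nonneg _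
  set c := δ / (M + 1)
  have hc : 0 < c := by positivity
  have hcM : c * M < δ := by
    rw [div_mul_eq_mul_div, div_lt_iff₀ (by positivity)]
    nlinarith
  set b : ℝ → ℝ := fun t => M * exp (-(c * t))
  have b_nonneg (t : ℝ) : 0 ≤ b t := by positivity
  have b_le (t : ℝ) (ht : 0 ≤ t) : b t ≤ M :=
    mul_le_of_le_one_right hM (exp_le_one_iff.2 (neg_nonpos.2 (by positivity)))
  have deriv_b (t : ℝ) : HasDerivAt b (-(c * b t)) t := by
    refine ((((hasDerivAt_id t).const_mul c).neg.exp).const_mul M).congr_deriv ?_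
    simp only [b, id_eq, Pi.neg_apply]
    ring
  have below_barrier (t : ℝ) (ht : 0 ≤ t) : (fun i => w t i - ε - b t) ≤ 0 := by
    refine le_zero_of_forall_deriv_neg (w := fun t i => w t i - ε - b t)
      (w' := fun t i => w' t i - -(c * b t)) (fun t ht => hasDerivWithinAt_pi.2 fun i =>
        ((hasDerivWithinAt_pi.1 (hw t ht) i).sub_const ε).sub (deriv_b t).hasDerivWithinAt)
      (fun i => ?_) (fun t ht hle i heq => ?_) ht
    · have : w 0 i - ε ≤ M := (le_abs_self _).trans (norm_le_pi_norm (fun i => w 0 i - ε) i)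
      simpa [b] using this
    · have le_barrier (j : ι) : w t j - ε - b t ≤ 0 := hle j
      have := hmax t ht i (fun j => by linarith [le_barrier j]) (by linarith [b_nonneg t])
      linarith [mul_le_mul_of_nonneg_left (b_le t ht) hc.le]
  have b_lim : Tendsto b atTop (𝓝 0) := by
    simpa using (Real.tendsto_exp_neg_atTop_nhds_zero.comp
      (tendsto_id.const_mul_atTop hc)).const_mul M
  filter_upwards [b_lim.eventually_le_const (sub_pos.2 hη), eventually_ge_atTop 0]
    with t hbt ht i
  linarith [show w t i - ε - b t ≤ 0 from below_barrier t ht i]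

end Barrier

/-- An off-diagonally antitone map whose coordinates strictly increase along translations by
positive constant vectors. Such maps are inverse isotone (see `IsStrictMFunction.le_of_map_le`), so
that they are M-functions in the sense of Rheinboldt. -/
structure IsStrictMFunction {ι : Type*} (G : (ι → ℝ) → ι → ℝ) : Prop where
  apply_le_of_le {u v : ι → ℝ} {i : ι} : u ≤ v → u i = v i → G v i ≤ G u i
  lt_translate (u : ι → ℝ) (i : ι) {s : ℝ} : 0 < s → G u i < G (fun j => u j + s) i

namespace IsStrictMFunction

variable {ι : Type*} {G : (ι → ℝ) → ι → ℝ}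

theorem neg_comp_neg (h : IsStrictMFunction G) : IsStrictMFunction fun u => -G (-u) where
  apply_le_of_le hle heq :=
    neg_le_neg (h.apply_le_of_le (neg_le_neg hle) (congrArg Neg.neg heq.symm))
  lt_translate u i s hs := by
    simpa [Pi.neg_def, add_comm] using neg_lt_neg (h.lt_translate (-fun j => u j + s) i hs)

theorem strictMono_translate (h : IsStrictMFunction G) (u : ι → ℝ) (i : ι) :
    StrictMono fun s : ℝ => G (fun j => u j + s) i := by
  intro s t hst
  simpa [add_assoc] using h.lt_translate (fun j => u j + s) i (sub_pos.2 hst)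

theorem le_of_map_le [Finite ι] (h : IsStrictMFunction G) {u v : ι → ℝ} (huv : G u ≤ G v) :
    u ≤ v := by
  by_contra hnot
  obtain ⟨j, hj⟩ := not_forall.1 hnot
  have : Nonempty ι := ⟨j⟩
  obtain ⟨i, hi⟩ := Finite.exists_max fun i => u i - v i
  have hs : 0 < u i - v i := (sub_pos.2 (not_le.1 hj)).trans_le (hi j)
  have le_translate : u ≤ fun j => v j + (u i - v i) := fun j => by linarith [hi j]
  exact lt_irrefl _ <| calc
    G v i < G (fun j => v j + (u i - v i)) i := h.lt_translate v i hs
    _ ≤ G u i := h.apply_le_of_le le_translate (by ring)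
    _ ≤ G v i := huv i

theorem injective [Finite ι] (h : IsStrictMFunction G) : Function.Injective G := fun _ _ huv =>
  le_antisymm (h.le_of_map_le huv.le) (h.le_of_map_le huv.ge)

theorem exists_map_eq [Finite ι] (h : IsStrictMFunction G) (hG : Continuous G) {u₀ y : ι → ℝ}
    (hu₀ : G u₀ ≤ y) (hb : Bornology.IsBounded {u | u₀ ≤ u ∧ G u ≤ y}) : ∃ u, G u = y := by
  classical
  cases nonempty_fintype ι
  have compact : IsCompact {u | u₀ ≤ u ∧ G u ≤ y} := Metric.isCompact_of_isClosed_isBounded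
    (isClosed_Ici.inter (isClosed_Iic.preimage hG)) hb
  obtain ⟨u, ⟨hu₀u, hu⟩, hmax⟩ := compact.exists_isMaxOn ⟨u₀, le_rfl, hu₀⟩
    (f := fun u => ∑ i, u i) (by fun_prop)
  refine ⟨u, hu.eq_of_not_lt fun hlt => ?_⟩
  obtain ⟨i, hi⟩ := (Pi.lt_def.1 hlt).2
  have raise_cont : Continuous fun s => G (Function.update u i s) i :=
    (continuous_apply i).comp (hG.comp (continuous_const.update i continuous_id))
  have : ∀ᶠ s in 𝓝[>] (u i), G (Function.update u i s) i < y i :=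
    (raise_cont.continuousAt.eventually_lt_const (by simpa using hi)).filter_mono
      nhdsWithin_le_nhds
  obtain ⟨s, hs, hus⟩ := (this.and self_mem_nhdsWithin).exists
  have le_update : u ≤ Function.update u i s := le_update_self_iff.2 (le_of_lt hus)
  have mem : Function.update u i s ∈ {u | u₀ ≤ u ∧ G u ≤ y} := by
    refine ⟨hu₀u.trans le_update, fun j => ?_⟩
    rcases eq_or_ne j i with rfl | hj
    · exact hs.le
    · exact (h.apply_le_of_le le_update (by simp [hj])).trans (hu j)
  refine (hmax mem).not_gt (Finset.sum_lt_sum (fun j _ => le_update j) ⟨i, Finset.mem_univ i, ?_⟩)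
  simpa using hus

theorem eventually_le_add_of_flow [Finite ι] (h : IsStrictMFunction G) {u : ℝ → ι → ℝ}
    {v : ι → ℝ} (hu : ∀ t, 0 ≤ t → HasDerivWithinAt u (G v - G (u t)) (Ici 0) t) {ε : ℝ}
    (hε : 0 < ε) : ∀ᶠ t in atTop, ∀ i, u t i ≤ v i + ε := by
  cases nonempty_fintype ι
  obtain ⟨δ, hδ, gap⟩ := Pi.exists_forall_pos_add_lt fun i => h.lt_translate v i (half_pos hε)
  have hw (t : ℝ) (ht : 0 ≤ t) :
      HasDerivWithinAt (fun t => u t - v) (G v - G (u t)) (Ici 0) t := (hu t ht).sub_const v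
  refine (eventually_le_of_max_deriv_le hw hδ (fun t _ i hmax hi => ?_) (half_lt_self hε)).mono
    fun t ht i => sub_le_iff_le_add'.1 (ht i)
  have le_translate : u t ≤ fun j => v j + (u t i - v i) := fun j =>
    sub_le_iff_le_add'.1 (hmax j)
  refine (sub_lt_iff_lt_add.2 ?_).le
  calc G v i < G (fun j => v j + ε / 2) i - δ := lt_sub_iff_add_lt.2 (gap i)
    _ ≤ G (fun j => v j + (u t i - v i)) i - δ := by
      gcongr; exact (h.strictMono_translate v i).monotone hi
    _ ≤ G (u t) i - δ := by gcongr; exact h.apply_le_of_le le_translate (by ring)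
    _ = -δ + G (u t) i := by ring

theorem tendsto_of_flow [Finite ι] (h : IsStrictMFunction G) {u : ℝ → ι → ℝ}
    {v : ι → ℝ} (hu : ∀ t, 0 ≤ t → HasDerivWithinAt u (G v - G (u t)) (Ici 0) t) :
    Tendsto u atTop (𝓝 v) := by
  cases nonempty_fintype ι
  have neg_flow (t : ℝ) (ht : 0 ≤ t) :
      HasDerivWithinAt (fun s => -u s) (-G (- -v) - -G (- -u t)) (Ici 0) t := by
    simp only [neg_neg, neg_sub_neg]
    exact (hu t ht).neg.congr_deriv (neg_sub _ _)
  refine tendsto_pi_nhds.2 fun i => Metric.tendsto_nhds.2 fun ε hε => ?_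
  filter_upwards [h.eventually_le_add_of_flow hu (half_pos hε),
    h.neg_comp_neg.eventually_le_add_of_flow neg_flow (half_pos hε)] with t hle hge
  have hge := hge i
  simp only [Pi.neg_apply] at hge
  rw [Real.dist_eq, abs_lt]
  constructor <;> linarith [hle i]

end IsStrictMFunction

/-! ### Flows of bounded vector fields -/

section ODE

variable {X : Type*} [NormedAddCommGroup X] [NormedSpace ℝ X] [FiniteDimensional ℝ X]
  {v : X → X}

open Manifold in
theorem exists_forall_hasDerivAt_of_bounded (hv : ContDiff ℝ 1 v) {C : ℝ} (hC : ∀ x, ‖v x‖ ≤ C)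
    (x₀ : X) : ∃ f : ℝ → X, f 0 = x₀ ∧ ∀ t, HasDerivAt f (v (f t)) t := by
  have : CompleteSpace X := FiniteDimensional.complete ℝ X
  lift C to NNReal using (norm_nonneg _).trans (hC x₀)
  have uniform_time (x : X) : ∃ f : ℝ → X, f 0 = x ∧
      IsMIntegralCurveOn (I := 𝓘(ℝ, X)) f v (Ioo (-1) 1) := by
    obtain ⟨K, hK⟩ := hv.contDiffOn.exists_lipschitzOnWith one_ne_zero
      (convex_closedBall x C) (isCompact_closedBall x C)
    have picard : IsPicardLindelof (fun _ => v) (⟨0, by norm_num⟩ : Icc (-1 : ℝ) 1) x C 0 C K :=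
      IsPicardLindelof.of_time_independent (fun y _ => hC y) hK (by simp)
    obtain ⟨f, hf₀, hf⟩ := picard.exists_eq_forall_mem_Icc_hasDerivWithinAt₀
    exact ⟨f, hf₀, fun t ht => ((hf t (Ioo_subset_Icc_self ht)).mono
      Ioo_subset_Icc_self).hasFDerivWithinAt.hasMFDerivWithinAt⟩
  obtain ⟨f, hf₀, hf⟩ := exists_isMIntegralCurve_of_isMIntegralCurveOn
    (contMDiff_vectorSpace_iff_contDiff.2 hv) one_pos uniform_time x₀
  exact ⟨f, hf₀, fun t => hasDerivAt_iff_hasFDerivAt.2 (hf t).hasFDerivAt⟩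

theorem eqOn_Ico_of_hasDerivWithinAt (hv : ContDiff ℝ 1 v) {T : ℝ} {f g : ℝ → X}
    (hf : ∀ t ∈ Ico 0 T, HasDerivWithinAt f (v (f t)) (Ico 0 T) t)
    (hg : ∀ t ∈ Ico 0 T, HasDerivWithinAt g (v (g t)) (Ico 0 T) t) (h₀ : f 0 = g 0) :
    EqOn f g (Ico 0 T) := by
  intro t ht
  have hsub : Icc 0 t ⊆ Ico 0 T := Icc_subset_Ico_right ht.2
  have continuousOn {h : ℝ → X} (hh : ∀ t ∈ Ico 0 T, HasDerivWithinAt h (v (h t)) (Ico 0 T) t) :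
      ContinuousOn h (Icc 0 t) := fun s hs => (hh s (hsub hs)).continuousWithinAt.mono hsub
  have right_deriv {h : ℝ → X} (hh : ∀ t ∈ Ico 0 T, HasDerivWithinAt h (v (h t)) (Ico 0 T) t)
      (s : ℝ) (hs : s ∈ Ico 0 t) : HasDerivWithinAt h (v (h s)) (Ici s) s := by
    have hsT : s < T := hs.2.trans ht.2
    exact (hh s ⟨hs.1, hsT⟩).mono_of_mem_nhdsWithin
      (mem_of_superset (Ico_mem_nhdsGE hsT) (Ico_subset_Ico_left hs.1))
  have compact : IsCompact (f '' Icc 0 t ∪ g '' Icc 0 t) :=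
    (isCompact_Icc.image_of_continuousOn (continuousOn hf)).union
      (isCompact_Icc.image_of_continuousOn (continuousOn hg))
  obtain ⟨R, hR⟩ := compact.isBounded.subset_closedBall 0
  obtain ⟨K, hK⟩ := hv.contDiffOn.exists_lipschitzOnWith one_ne_zero
    (convex_closedBall 0 R) (isCompact_closedBall 0 R)
  exact ODE_solution_unique_of_mem_Icc_right (fun _ _ => hK)
    (continuousOn hf) (right_deriv hf)
    (fun s hs => hR (.inl ⟨s, Ico_subset_Icc_self hs, rfl⟩)) (continuousOn hg) (right_deriv hg)
    (fun s hs => hR (.inr ⟨s, Ico_subset_Icc_self hs, rfl⟩)) h₀ ⟨ht.1, le_rfl⟩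

end ODE

/-! ### Total geodesic curvatures and the reduced flow -/

section ExtendZero

variable {F : Type*} {I : Finset F} {f : F}

/-- The vector of curvatures on `I` with logarithms `u`, extended by zero to the other faces. -/
def ofLog (I : Finset F) (u : I → ℝ) : F → ℝ := extendZero I fun i => exp (u i)

theorem ofLog_of_mem (u : I → ℝ) (hf : f ∈ I) : ofLog I u f = exp (u ⟨f, hf⟩) := dif_pos hf

theorem ofLog_of_notMem (u : I → ℝ) (hf : f ∉ I) : ofLog I u f = 0 := dif_neg hf

theorem ofLog_log {k : I → ℝ} (hk : ∀ i, 0 < k i) :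
    ofLog I (fun i => log (k i)) = extendZero I k :=
  congrArg (extendZero I) (funext fun i => exp_log (hk i))

theorem ofLog_mem_positiveOn (u : I → ℝ) : ofLog I u ∈ positiveOn I :=
  ⟨fun _ hf => by rw [ofLog_of_mem u hf]; exact exp_pos _, fun _ => ofLog_of_notMem u⟩

theorem nonneg_of_mem_positiveOn {k : F → ℝ} (hk : k ∈ positiveOn I) : 0 ≤ k := by
  intro f
  by_cases hf : f ∈ I
  · exact (hk.1 f hf).le
  · exact (hk.2 f hf).ge

theorem exists_ofLog_eq {k : F → ℝ} (hk : k ∈ positiveOn I) : ∃ u, ofLog I u = k := by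
  refine ⟨fun i => log (k i), funext fun f => ?_⟩
  by_cases hf : f ∈ I
  · rw [ofLog_of_mem _ hf, exp_log (hk.1 f hf)]
  · rw [ofLog_of_notMem _ hf, hk.2 f hf]

theorem monotone_ofLog : Monotone (ofLog I) := by
  intro u v huv f
  by_cases hf : f ∈ I
  · simpa only [ofLog_of_mem _ hf, exp_le_exp] using huv _
  · simp only [ofLog_of_notMem _ hf, le_refl]

theorem ofLog_add_const (u : I → ℝ) (s : ℝ) : ofLog I (fun i => u i + s) = exp s • ofLog I u := by
  funext f
  by_cases hf : f ∈ I
  · simp only [Pi.smul_apply, ofLog_of_mem _ hf, smul_eq_mul, exp_add, mul_comm]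
  · simp only [Pi.smul_apply, ofLog_of_notMem _ hf, smul_zero]

theorem tendsto_ofLog_atTop {α : Type*} {l : Filter α} {u : α → I → ℝ} (hf : f ∈ I)
    (hu : Tendsto (fun x => u x ⟨f, hf⟩) l atTop) :
    Tendsto (fun x => ofLog I (u x) f) l atTop := by
  simp only [ofLog_of_mem _ hf]
  exact tendsto_exp_atTop.comp hu

theorem contDiff_ofLog_apply {n : WithTop ℕ∞} (I : Finset F) (f : F) :
    ContDiff ℝ n fun u => ofLog I u f := by
  by_cases hf : f ∈ I
  · simp only [ofLog_of_mem _ hf]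
    fun_prop
  · simp only [ofLog_of_notMem _ hf]
    fun_prop

end ExtendZero

section EdgeSum

variable {S V E F : Type*} [TopologicalSpace S] (D : CellularDecomposition S V E F)

theorem face_side_symm (p : Σ f : F, Fin (D.numSides f)) : D.face (D.side.symm p) = p.1 := by
  rw [CellularDecomposition.face, Equiv.apply_symm_apply]

/-- The contribution of the side `s` to the total geodesic curvature of its face. -/
def sideTerm (Φ : E → ℝ) (k : F → ℝ) (s : E × Bool) : ℝ :=
  sideCurvature (Φ s.1) (k (D.face s)) (k (D.face (s.1, !s.2)))

theorem totalCurvature_eq_sum_sideTerm (Φ : E → ℝ) (k : F → ℝ) (f : F) :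
    totalCurvature D Φ k f = ∑ j : Fin (D.numSides f), sideTerm D Φ k (D.side.symm ⟨f, j⟩) := by
  simp only [totalCurvature, sideTerm, face_side_symm]

open scoped Classical in
theorem sum_totalCurvature_eq_sum_edgesOf [Fintype E] (Φ : E → ℝ) (k : F → ℝ) (F' : Finset F) :
    ∑ f ∈ F', totalCurvature D Φ k f =
      ∑ e ∈ D.edgesOf F', ∑ b : Bool with D.face (e, b) ∈ F', sideTerm D Φ k (e, b) := by
  simp only [totalCurvature_eq_sum_sideTerm, Finset.sum_sigma']
  refine Finset.sum_bij' (fun p _ => ⟨(D.side.symm p).1, (D.side.symm p).2⟩)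
    (fun s _ => D.side (s.1, s.2)) (fun p hp => ?_) (fun s hs => ?_) (fun p _ => by simp)
    (fun s _ => by simp) (fun p _ => rfl)
  · have mem : D.face (D.side.symm p) ∈ F' := by simpa [face_side_symm] using hp
    have edge_mem : (D.side.symm p).1 ∈ D.edgesOf F' :=
      Finset.mem_filter.2 ⟨Finset.mem_univ _, _, mem, (D.side.symm p).2, rfl⟩
    simpa [edge_mem] using mem
  · have mem := (Finset.mem_filter.1 (Finset.mem_sigma.1 hs).2).2
    exact Finset.mem_sigma.2 ⟨mem, Finset.mem_univ _⟩

variable {α : Type*} {l : Filter α} {Φ : E → ℝ} {k : α → F → ℝ} {F' : Finset F} {c : ℝ}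

open scoped Classical in
theorem eventually_mul_le_sum_sideTerm {e : E} (hΦ : Φ e ∈ Ioo 0 π)
    (hF' : ∀ f ∈ F', Tendsto (k · f) l atTop) (hF'' : ∀ f ∉ F', ∃ β, Tendsto (k · f) l (𝓝 β))
    (he : ∃ b, D.face (e, b) ∈ F') (hc : c < 1) :
    ∀ᶠ x in l, c * (2 * Φ e) ≤ ∑ b with D.face (e, b) ∈ F', sideTerm D Φ (k x) (e, b) := by
  obtain ⟨b, hb⟩ := he
  by_cases hb' : D.face (e, !b) ∈ F'
  · have both (b' : Bool) : D.face (e, b') ∈ F' := by cases b <;> cases b' <;> assumption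
    simp only [both, Finset.filter_true, Fintype.sum_bool]
    exact eventually_mul_le_sideCurvature_add hΦ hc (hF' _ (both true)) (hF' _ (both false))
  · have only : ({b' | D.face (e, b') ∈ F'} : Finset Bool) = {b} := by
      ext b'
      cases b <;> cases b' <;> simpa
    obtain ⟨β, hβ⟩ := hF'' _ hb'
    simp only [only, Finset.sum_singleton]
    refine (tendsto_sideCurvature hΦ (hF' _ hb) hβ).eventually_const_le ?_
    exact mul_lt_of_lt_one_left (by linarith [hΦ.1]) hc

theorem eventually_mul_le_sum_totalCurvature [Fintype E] (hΦ : ∀ e, Φ e ∈ Ioo 0 π)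
    (hF' : ∀ f ∈ F', Tendsto (k · f) l atTop) (hF'' : ∀ f ∉ F', ∃ β, Tendsto (k · f) l (𝓝 β))
    (hc : c < 1) :
    ∀ᶠ x in l, c * (2 * ∑ e ∈ D.edgesOf F', Φ e) ≤ ∑ f ∈ F', totalCurvature D Φ (k x) f := by
  classical
  have edgewise : ∀ e ∈ D.edgesOf F', ∀ᶠ x in l,
      c * (2 * Φ e) ≤ ∑ b with D.face (e, b) ∈ F', sideTerm D Φ (k x) (e, b) := fun e he =>
    eventually_mul_le_sum_sideTerm D (hΦ e) hF' hF''
      (by simpa [CellularDecomposition.edgesOf] using he) hc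
  filter_upwards [(Finset.eventually_all _).2 edgewise] with x hx
  rw [sum_totalCurvature_eq_sum_edgesOf, Finset.mul_sum, Finset.mul_sum]
  exact Finset.sum_le_sum hx

end EdgeSum

section TotalCurvature

variable {S V E F : Type*} [TopologicalSpace S] (D : CellularDecomposition S V E F) {Φ : E → ℝ}

theorem exists_pos_totalCurvature_eq_mul (hΦ : ∀ e, Φ e ∈ Ioo 0 π) (k : F → ℝ) (f : F) :
    ∃ ℓ > 0, totalCurvature D Φ k f = ℓ * k f := by
  have : Nonempty (Fin (D.numSides f)) := ⟨⟨0, D.numSides_pos f⟩⟩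
  exact ⟨_, Finset.sum_pos (fun j _ => bigonSideLength_pos (hΦ _) (radius_mem_Ioo _)
    (radius_mem_Ioo _)) Finset.univ_nonempty, (Finset.sum_mul ..).symm⟩

theorem totalCurvature_mem_positiveOn_iff (hΦ : ∀ e, Φ e ∈ Ioo 0 π) {I : Finset F} {k : F → ℝ} :
    totalCurvature D Φ k ∈ positiveOn I ↔ k ∈ positiveOn I := by
  refine and_congr (forall₂_congr fun f _ => ?_) (forall₂_congr fun f _ => ?_) <;>
    obtain ⟨ℓ, hℓ, heq⟩ := exists_pos_totalCurvature_eq_mul D hΦ k f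
  · rw [heq, mul_pos_iff_of_pos_left hℓ]
  · rw [heq, mul_eq_zero_iff_left hℓ.ne']

theorem totalCurvature_zero (hΦ : ∀ e, Φ e ∈ Ioo 0 π) : totalCurvature D Φ 0 = 0 := by
  funext f
  obtain ⟨ℓ, -, heq⟩ := exists_pos_totalCurvature_eq_mul D hΦ 0 f
  rw [heq, Pi.zero_apply, mul_zero]

theorem abs_totalCurvature_le (hΦ : ∀ e, Φ e ∈ Ioo 0 π) (k : F → ℝ) (f : F) :
    |totalCurvature D Φ k f| ≤ D.numSides f * (2 * π) :=
  (Finset.abs_sum_le_sum_abs _ _).trans <|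
    (Finset.sum_le_card_nsmul _ _ _ fun _ _ => abs_sideCurvature_le (hΦ _) _ _).trans_eq (by simp)

theorem continuous_totalCurvature (hΦ : ∀ e, Φ e ∈ Ioo 0 π) : Continuous (totalCurvature D Φ) := by
  unfold totalCurvature
  refine continuous_pi fun f => continuous_finsetSum _ fun j _ => ?_
  exact (contDiff_sideCurvature (n := 0) (hΦ _)).continuous.comp₂
    (continuous_apply f) (continuous_apply _)

theorem contDiff_totalCurvature_comp {X : Type*} [NormedAddCommGroup X] [NormedSpace ℝ X]
    {n : WithTop ℕ∞} {k : X → F → ℝ} (hΦ : ∀ e, Φ e ∈ Ioo 0 π)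
    (hk : ∀ f, ContDiff ℝ n fun x => k x f) (f : F) :
    ContDiff ℝ n fun x => totalCurvature D Φ (k x) f := by
  unfold totalCurvature
  exact ContDiff.sum fun _ _ => (contDiff_sideCurvature (hΦ _)).comp₂ (hk f) (hk _)

theorem totalCurvature_le_of_le (hΦ : ∀ e, Φ e ∈ Ioo 0 π) {k k' : F → ℝ} {f : F} (hf : 0 ≤ k f)
    (hle : k ≤ k') (heq : k f = k' f) : totalCurvature D Φ k' f ≤ totalCurvature D Φ k f :=
  Finset.sum_le_sum fun _ _ => by
    rw [← heq]
    exact antitone_sideCurvature (hΦ _) hf (hle _)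

theorem totalCurvature_lt_totalCurvature_smul (hΦ : ∀ e, Φ e ∈ Ioo 0 π) {k : F → ℝ} {f : F}
    (hf : 0 < k f) {t : ℝ} (ht : 1 < t) :
    totalCurvature D Φ k f < totalCurvature D Φ (t • k) f := by
  have : Nonempty (Fin (D.numSides f)) := ⟨⟨0, D.numSides_pos f⟩⟩
  exact Finset.sum_lt_sum_of_nonempty Finset.univ_nonempty fun j _ =>
    sideCurvature_lt_sideCurvature_mul (hΦ _) hf _ ht

end TotalCurvature

theorem exists_ultrafilter_tendsto_atTop_or_nhds {ι : Type*} [Finite ι] {A : Set (ι → ℝ)}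
    (hA : BddBelow A) (hunb : ¬ Bornology.IsBounded A) :
    ∃ U : Ultrafilter (ι → ℝ), A ∈ U ∧ (∃ i, Tendsto (fun u : ι → ℝ => u i) U atTop) ∧
      ∀ i, Tendsto (fun u : ι → ℝ => u i) U atTop ∨
        ∃ β, Tendsto (fun u : ι → ℝ => u i) U (𝓝 β) := by
  cases nonempty_fintype ι
  have : NeBot (Bornology.cobounded (ι → ℝ) ⊓ 𝓟 A) := by
    rwa [neBot_iff, Ne, ← disjoint_iff, disjoint_principal_right]
  obtain ⟨U, hU⟩ := Ultrafilter.exists_le (Bornology.cobounded (ι → ℝ) ⊓ 𝓟 A)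
  have hUA : A ∈ U := le_principal_iff.1 (hU.trans inf_le_right)
  have dichotomy (i : ι) : Tendsto (fun u : ι → ℝ => u i) U atTop ∨
      ∃ β, Tendsto (fun u : ι → ℝ => u i) U (𝓝 β) := by
    refine or_iff_not_imp_left.2 fun hi => ?_
    obtain ⟨m, hm⟩ := hA
    obtain ⟨c, hc⟩ := not_forall.1 (mt tendsto_atTop.2 hi)
    have mem_Icc : ∀ᶠ u : ι → ℝ in U, u i ∈ Icc (m i) c := by
      filter_upwards [hUA, U.eventually_not.2 hc] with u hu huc using ⟨hm hu i, (not_le.1 huc).le⟩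
    obtain ⟨β, -, hβ⟩ := isCompact_Icc.ultrafilter_le_nhds' (U.map fun u : ι → ℝ => u i) mem_Icc
    exact ⟨β, hβ⟩
  refine ⟨U, hUA, ?_, dichotomy⟩
  by_contra! hnone
  choose β hβ using fun i => (dichotomy i).resolve_left (hnone i)
  exact U.neBot.ne <| le_bot_iff.1 <|
    Metric.disjoint_nhds_cobounded β (tendsto_pi_nhds.2 hβ) (hU.trans inf_le_left)

section Reduced

variable {S V E F : Type*} [TopologicalSpace S] (D : CellularDecomposition S V E F)

/-- The total geodesic curvatures of the faces of `I`, as functions of the logarithms of the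
geodesic curvatures; in these coordinates the reduced flow is `du/dt = L̂ - L`. -/
def logCurvature (Φ : E → ℝ) (I : Finset F) (u : I → ℝ) : I → ℝ :=
  I.restrict (totalCurvature D Φ (ofLog I u))

variable {Φ : E → ℝ} {I : Finset F}

theorem contDiff_logCurvature (hΦ : ∀ e, Φ e ∈ Ioo 0 π) {n : WithTop ℕ∞} :
    ContDiff ℝ n (logCurvature D Φ I) :=
  contDiff_pi.2 fun i => contDiff_totalCurvature_comp D hΦ (contDiff_ofLog_apply I) i

theorem exists_forall_norm_logCurvature_le (hΦ : ∀ e, Φ e ∈ Ioo 0 π) (I : Finset F) :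
    ∃ C, ∀ u, ‖logCurvature D Φ I u‖ ≤ C := by
  refine ⟨∑ i : I, D.numSides i * (2 * π), fun u => ?_⟩
  refine (pi_norm_le_iff_of_nonneg (by positivity)).2 fun i => ?_
  exact (abs_totalCurvature_le D hΦ _ _).trans <|
    Finset.single_le_sum (f := fun i : I => (D.numSides i : ℝ) * (2 * π))
      (fun _ _ => by positivity) (Finset.mem_univ i)

theorem isStrictMFunction_logCurvature (hΦ : ∀ e, Φ e ∈ Ioo 0 π) (I : Finset F) :
    IsStrictMFunction (logCurvature D Φ I) where
  apply_le_of_le {u v i} huv hi :=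
    totalCurvature_le_of_le D hΦ ((ofLog_mem_positiveOn u).1 i i.2).le (monotone_ofLog huv)
      (by rw [ofLog_of_mem u i.2, ofLog_of_mem v i.2, hi])
  lt_translate u i s hs := by
    rw [logCurvature, logCurvature, ofLog_add_const]
    exact totalCurvature_lt_totalCurvature_smul D hΦ ((ofLog_mem_positiveOn u).1 i i.2)
      (one_lt_exp_iff.2 hs)

theorem tendsto_logCurvature_const_atBot (hΦ : ∀ e, Φ e ∈ Ioo 0 π) :
    Tendsto (fun s => logCurvature D Φ I fun _ => s) atBot (𝓝 0) := by
  have ofLog_lim : Tendsto (fun s => ofLog I fun _ => s) atBot (𝓝 0) := by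
    refine tendsto_pi_nhds.2 fun f => ?_
    by_cases hf : f ∈ I
    · simpa only [ofLog_of_mem _ hf, Pi.zero_apply] using tendsto_exp_atBot
    · simp only [ofLog_of_notMem _ hf, Pi.zero_apply, tendsto_const_nhds]
  have lim := ((continuous_totalCurvature D hΦ).tendsto 0).comp ofLog_lim
  rw [totalCurvature_zero D hΦ] at lim
  exact tendsto_pi_nhds.2 fun i => tendsto_pi_nhds.1 lim i

theorem isBounded_setOf_logCurvature_le [Fintype E] (hΦ : ∀ e, Φ e ∈ Ioo 0 π) {L : F → ℝ}
    (hL : L ∈ prescribable D Φ I) (u₀ : I → ℝ) :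
    Bornology.IsBounded {u | u₀ ≤ u ∧ logCurvature D Φ I u ≤ I.restrict L} := by
  classical
  by_contra hunb
  obtain ⟨U, hU, ⟨i₀, hi₀⟩, dichotomy⟩ :=
    exists_ultrafilter_tendsto_atTop_or_nhds ⟨u₀, fun _ hu => hu.1⟩ hunb
  set F' : Finset F := {f ∈ I | Tendsto (ofLog I · f) U atTop}
  have infinite : ∀ f ∈ F', Tendsto (ofLog I · f) U atTop := fun f hf => (Finset.mem_filter.1 hf).2
  have finite : ∀ f ∉ F', ∃ β, Tendsto (ofLog I · f) U (𝓝 β) := by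
    intro f hf
    by_cases hfI : f ∈ I
    · rcases dichotomy ⟨f, hfI⟩ with h | ⟨β, hβ⟩
      · exact absurd (Finset.mem_filter.2 ⟨hfI, tendsto_ofLog_atTop hfI h⟩) hf
      · exact ⟨exp β, by simpa only [ofLog_of_mem _ hfI] using hβ.rexp⟩
    · exact ⟨0, by simpa only [ofLog_of_notMem _ hfI] using tendsto_const_nhds⟩
  have nonempty : F'.Nonempty :=
    ⟨i₀, Finset.mem_filter.2 ⟨i₀.2, tendsto_ofLog_atTop i₀.2 hi₀⟩⟩
  have lt_edges := hL.2 F' (Finset.filter_subset _ _) nonempty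
  have near_one : ∀ᶠ c in 𝓝[<] (1 : ℝ), ∑ f ∈ F', L f < c * (2 * ∑ e ∈ D.edgesOf F', Φ e) :=
    (((continuous_mul_const _).tendsto' 1 _ (one_mul _)).mono_left
      nhdsWithin_le_nhds).eventually_const_lt lt_edges
  obtain ⟨c, hc, hc₁⟩ := (near_one.and self_mem_nhdsWithin).exists
  obtain ⟨u, hu, huA⟩ :=
    ((eventually_mul_le_sum_totalCurvature D hΦ infinite finite hc₁).and hU).exists
  refine (hc.trans_le hu).not_ge (Finset.sum_le_sum fun f hf => ?_)
  exact huA.2 ⟨f, (Finset.mem_filter.1 hf).1⟩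

theorem exists_logCurvature_eq [Fintype E] (hΦ : ∀ e, Φ e ∈ Ioo 0 π) {L : F → ℝ}
    (hL : L ∈ prescribable D Φ I) : ∃ u, logCurvature D Φ I u = I.restrict L := by
  have subsolution : ∀ᶠ s in atBot, (logCurvature D Φ I fun _ => s) ≤ I.restrict L :=
    eventually_all.2 fun i => (tendsto_pi_nhds.1 (tendsto_logCurvature_const_atBot D hΦ)
      i).eventually_le_const (hL.1.1 i i.2)
  obtain ⟨s, hs⟩ := subsolution.exists
  exact (isStrictMFunction_logCurvature D hΦ I).exists_map_eq
    (contDiff_logCurvature (n := 0) D hΦ).continuous hs (isBounded_setOf_logCurvature_le D hΦ hL _)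

end Reduced

section Flow

variable {S V E F : Type*} [TopologicalSpace S] {D : CellularDecomposition S V E F} {Φ : E → ℝ}
  {I : Finset F} {L : F → ℝ}

theorem isFlowSolution_exp {J : Set ℝ} {u : ℝ → I → ℝ}
    (hu : ∀ t ∈ J, HasDerivWithinAt u (I.restrict L - logCurvature D Φ I (u t)) J t) :
    IsFlowSolution D Φ I L J fun t i => exp (u t i) := by
  refine fun t ht i => ⟨exp_pos _, ((hasDerivWithinAt_pi.1 (hu t ht) i).exp).congr_deriv ?_⟩
  rw [neg_sub, mul_comm]
  rfl

theorem IsFlowSolution.hasDerivWithinAt_log {J : Set ℝ} {k : ℝ → I → ℝ}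
    (hk : IsFlowSolution D Φ I L J k) {t : ℝ} (ht : t ∈ J) :
    HasDerivWithinAt (fun t i => log (k t i))
      (I.restrict L - logCurvature D Φ I fun i => log (k t i)) J t := by
  refine hasDerivWithinAt_pi.2 fun i => ((hk t ht i).2.log (hk t ht i).1.ne').congr_deriv ?_
  rw [mul_div_cancel_right₀ _ (hk t ht i).1.ne', neg_sub, logCurvature,
    ofLog_log fun i => (hk t ht i).1]
  rfl

theorem IsFlowSolution.mono {J J' : Set ℝ} {k : ℝ → I → ℝ} (hk : IsFlowSolution D Φ I L J k)
    (hJ : J' ⊆ J) : IsFlowSolution D Φ I L J' k :=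
  fun t ht i => ⟨(hk t (hJ ht) i).1, (hk t (hJ ht) i).2.mono hJ⟩

theorem exists_isFlowSolution (hΦ : ∀ e, Φ e ∈ Ioo 0 π) {k₀ : I → ℝ} (hk₀ : ∀ i, 0 < k₀ i) :
    ∃ k : ℝ → I → ℝ, k 0 = k₀ ∧ IsFlowSolution D Φ I L (Ici 0) k := by
  obtain ⟨C, hC⟩ := exists_forall_norm_logCurvature_le D hΦ I
  obtain ⟨u, hu₀, hu⟩ := exists_forall_hasDerivAt_of_bounded
    (contDiff_const.sub (contDiff_logCurvature D hΦ))
    (fun v => (norm_sub_le (I.restrict L) _).trans (add_le_add_right (hC v) _))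
    (fun i => log (k₀ i))
  refine ⟨fun t i => exp (u t i), funext fun i => ?_,
    isFlowSolution_exp fun t _ => (hu t).hasDerivWithinAt⟩
  simp only [hu₀, exp_log (hk₀ i)]

theorem IsFlowSolution.eqOn (hΦ : ∀ e, Φ e ∈ Ioo 0 π) {T : ℝ} {k k' : ℝ → I → ℝ}
    (hk : IsFlowSolution D Φ I L (Ico 0 T) k) (hk' : IsFlowSolution D Φ I L (Ico 0 T) k')
    (h₀ : k 0 = k' 0) : EqOn k k' (Ico 0 T) := by
  have log_eqOn := eqOn_Ico_of_hasDerivWithinAt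
    (contDiff_const.sub (contDiff_logCurvature D hΦ)) (fun _ => hk.hasDerivWithinAt_log)
    (fun _ => hk'.hasDerivWithinAt_log) (by rw [h₀])
  exact fun t ht => funext fun i =>
    log_injOn_pos (hk t ht i).1 (hk' t ht i).1 (congrFun (log_eqOn ht) i)

theorem IsFlowSolution.tendsto_extendZero (hΦ : ∀ e, Φ e ∈ Ioo 0 π) {k : ℝ → I → ℝ}
    (hk : IsFlowSolution D Φ I L (Ici 0) k) {khat : F → ℝ} (hkhat : khat ∈ positiveOn I)
    (heq : totalCurvature D Φ khat = L) :
    Tendsto (fun t => extendZero I (k t)) atTop (𝓝 khat) := by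
  obtain ⟨v, rfl⟩ := exists_ofLog_eq hkhat
  have log_lim : Tendsto (fun t i => log (k t i)) atTop (𝓝 v) := by
    refine (isStrictMFunction_logCurvature D hΦ I).tendsto_of_flow fun t ht => ?_
    have flow := hk.hasDerivWithinAt_log ht
    rwa [← heq] at flow
  have ofLog_lim : Tendsto (fun t => ofLog I fun i => log (k t i)) atTop (𝓝 (ofLog I v)) :=
    ((continuous_pi fun f => (contDiff_ofLog_apply (n := 0) I f).continuous).tendsto v).comp log_lim
  refine ofLog_lim.congr' ?_
  filter_upwards [eventually_ge_atTop 0] with t ht using ofLog_log fun i => (hk t ht i).1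

theorem exists_totalCurvature_eq_iff [Fintype E] (hΦ : ∀ e, Φ e ∈ Ioo 0 π)
    (hL : L ∈ prescribable D Φ I) :
    ∃ khat ∈ positiveOn I, ∀ k, totalCurvature D Φ k = L ↔ k = khat := by
  obtain ⟨v, hv⟩ := exists_logCurvature_eq D hΦ hL
  have solves : totalCurvature D Φ (ofLog I v) = L := by
    have mem := (totalCurvature_mem_positiveOn_iff D hΦ).2 (ofLog_mem_positiveOn v)
    funext f
    by_cases hf : f ∈ I
    · exact congrFun hv ⟨f, hf⟩
    · rw [mem.2 f hf, hL.1.2 f hf]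
  refine ⟨ofLog I v, ofLog_mem_positiveOn v, fun k => ⟨fun hk => ?_, fun hk => hk ▸ solves⟩⟩
  obtain ⟨u, rfl⟩ := exists_ofLog_eq ((totalCurvature_mem_positiveOn_iff D hΦ).1 (hk ▸ hL.1))
  have same_curvature : logCurvature D Φ I u = logCurvature D Φ I v := by
    rw [logCurvature, logCurvature, hk, solves]
  rw [(isStrictMFunction_logCurvature D hΦ I).injective same_curvature]

end Flow

theorem theorem1p8_general {S V E F : Type*} [TopologicalSpace S] [Fintype E]
    (D : CellularDecomposition S V E F) {Φ : E → ℝ} (hΦ : ∀ e, Φ e ∈ Ioo 0 π) {I : Finset F}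
    {L : F → ℝ} (hL : L ∈ prescribable D Φ I) :
    ∃ khat ∈ positiveOn I, (∀ k, totalCurvature D Φ k = L ↔ k = khat) ∧
      ∀ k₀ : I → ℝ, (∀ i, 0 < k₀ i) →
        ∃ k : ℝ → I → ℝ,
          (k 0 = k₀ ∧ IsFlowSolution D Φ I L (Ici 0) k) ∧
          (∀ T > 0, ∀ k' : ℝ → I → ℝ, k' 0 = k₀ →
            IsFlowSolution D Φ I L (Ico 0 T) k' → EqOn k' k (Ico 0 T)) ∧
          Tendsto (fun t => extendZero I (k t)) atTop (𝓝 khat) := by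
  obtain ⟨khat, hpos, hkhat⟩ := exists_totalCurvature_eq_iff hΦ hL
  refine ⟨khat, hpos, hkhat, fun k₀ hk₀ => ?_⟩
  obtain ⟨k, hk_init, hk⟩ := exists_isFlowSolution (D := D) (L := L) hΦ hk₀
  refine ⟨k, ⟨hk_init, hk⟩, fun T _ k' hk'_init hk' => ?_,
    hk.tendsto_extendZero hΦ hpos ((hkhat khat).2 rfl)⟩
  exact hk'.eqOn hΦ (hk.mono Ico_subset_Ici_self) (hk'_init.trans hk_init.symm)

end

theorem theorem1p8 {S V E F : Type*} [TopologicalSpace S] [T2Space S] [CompactSpace S]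
    [ChartedSpace (EuclideanSpace ℝ (Fin 2)) S] [Fintype V] [Fintype E] [Fintype F]
    (D : CellularDecomposition S V E F)
    (Φ : E → ℝ) (hΦ : ∀ e, Φ e ∈ Set.Ioo 0 (Real.pi / 2))
    (I : Finset F) (hI : I.Nonempty) (hI' : I ≠ Finset.univ)
    (Lhat : F → ℝ) (hL : Lhat ∈ prescribable D Φ I) :
    ∃ khat : F → ℝ,
      (IsDegeneratedMetric khat ∧ totalCurvature D Φ khat = Lhat) ∧
      (∀ k : F → ℝ, IsDegeneratedMetric k → totalCurvature D Φ k = Lhat → k = khat) ∧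
      khat ∈ positiveOn I ∧
      ∀ k₀ : I → ℝ, (∀ i, 0 < k₀ i) →
        ∃ k : ℝ → I → ℝ,
          (k 0 = k₀ ∧ IsFlowSolution D Φ I Lhat (Set.Ici 0) k) ∧
          (∀ T > 0, ∀ k' : ℝ → I → ℝ, k' 0 = k₀ →
            IsFlowSolution D Φ I Lhat (Set.Ico 0 T) k' → Set.EqOn k' k (Set.Ico 0 T)) ∧
          Filter.Tendsto (fun t => extendZero I (k t)) Filter.atTop (nhds khat) := by
  obtain ⟨khat, hpos, hkhat, hflow⟩ := theorem1p8_general D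
    (fun e => Ioo_subset_Ioo_right (half_le_self Real.pi_pos.le) (hΦ e)) hL
  obtain ⟨f, hf⟩ : ∃ f, f ∉ I := by simpa [Finset.eq_univ_iff_forall] using hI'
  exact ⟨khat, ⟨⟨nonneg_of_mem_positiveOn hpos, f, hpos.2 f hf⟩, (hkhat khat).2 rfl⟩,
    fun k _ => (hkhat k).1, hpos, hflow⟩
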